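/- \textbf{Setting.} Let $m,q,l,H,K$ be natural numbers, $n=m+q$, $T=KH$, and let $\mathcal X_1,\dots,\mathcal X_n$ be finite nonempty sets. Let $\mathcal S=\prod_{i=1}^{m}\mathcal X_i$ be the state space, $\mathcal A=\prod_{i=m+1}^{n}\mathcal X_i$ the action space, and $\mathcal X=\mathcal S\times\mathcal A=\prod_{i=1}^n\mathcal X_i$ (a normal factored structure). For $I\subset[n]$ and $x\in\mathcal X$ let $\mathcal X[I]=\prod_{i\in I}\mathcal X_i$, $X[I]=|\mathcal X[I]|$, and let $x[I]\in\mathcal X[I]$ be the restriction of $x$ to $I$. Fix transition scopes $Z^P_1,\dots,Z^P_m\subset[n]$ and reward scopes $Z^R_1,\dots,Z^R_l\subset[n]$. A factored MDP (FMDP) with this structure has transition probabilities $P(s'\mid x)=\prod_{i=1}^m P_i(s'[i]\mid x[Z^P_i])$ and stochastic reward $r(x)=\sum_{i=1}^l r_i(x[Z^R_i])$, where the components $r_i$ are independent, each $r_i$ takes values in $[0,1]$, and so does $r$. An episode has $H$ steps and starts in a given initial state. A policy assigns to every state and step a probability distribution on $\mathcal A$; $V_1^\pi(s)$ is the expected total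 reward of an episode started in $s$ under $\pi$, and $V_1^*(s)=\max_\pi V_1^\pi(s)$. An algorithm chooses the policy $\pi_k$ of episode $k$, possibly at random, as a function of what was observed in the previous episodes (policies used, states, actions, and all reward components); it knows the factored structure, $H$ and $K$, but neither the transitions nor the rewards. For initial states $s_{1,1},\dots,s_{K,1}$ of the $K$ episodes, the expected regret is $\mathbb E\bigl[\sum_{k=1}^K (V_1^*(s_{k,1})-V_1^{\pi_k}(s_{k,1}))\bigr]$. \textbf{Theorem (degenerate case 2).} There is a universal constant $c>0$ such that the following holds for every such structure and all $H,K$. Suppose that $Z^R_i\subset\{m+1,\dots,n\}$ for all $i\in[l]$ (all rewards depend on action components only), that $X[Z^R_i]\ge 2$ for at least one $i$, and that $T\ge\max_{i} X[Z^R_i]$. Then for every algorithm there are an FMDP with the given structure and initial states of the episodes for which the expected regret in $K$ episodes is at least $$c\,\max_{i\in[l]}\sqrt{X[Z^R_i]\,T}.$$ -/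

import Mathlib

open MeasureTheory ProbabilityTheory
open scoped ENNReal

universe u

namespace FactoredMDP

section Spaces

variable {m q : ℕ}

/-- State space of the normal factored structure: the product of the first `m` of the
`n = m + q` components of the state-action space. -/
def State (X : Fin (m + q) → Type u) : Type u := (i : Fin m) → X (Fin.castAdd q i)

/-- Action space of the normal factored structure: the product of the last `q = n - m`
components of the state-action space. -/
def Action (X : Fin (m + q) → Type u) : Type u := (j : Fin q) → X (Fin.natAdd m j)

/-- The scope `𝒳[I]`: the product of the components with index in `I`. -/
abbrev Scope (X : Fin (m + q) → Type u) (I : Finset (Fin (m + q))) : Type u := (i : I) → X i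

/-- The state-action pair `x = (s, a)` as an element of the product of all `n` components. -/
def pair {X : Fin (m + q) → Type u} (s : State X) (a : Action X) : (i : Fin (m + q)) → X i :=
  Fin.addCases s a

/-- The scope variable `x[I]`. -/
def scopeVar {X : Fin (m + q) → Type u} (I : Finset (Fin (m + q))) (x : (i : Fin (m + q)) → X i) :
    Scope X I := fun i => x i

/-- The cardinality `X[I]` of the scope `𝒳[I]`. -/
def scopeCard (X : Fin (m + q) → Type u) [∀ i, Fintype (X i)] (I : Finset (Fin (m + q))) : ℕ :=
  Fintype.card (Scope X I)

variable (X : Fin (m + q) → Type u)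

instance [∀ i, Fintype (X i)] : Fintype (State X) :=
  inferInstanceAs (Fintype ((i : Fin m) → X (Fin.castAdd q i)))
instance [∀ i, Fintype (X i)] : Fintype (Action X) :=
  inferInstanceAs (Fintype ((j : Fin q) → X (Fin.natAdd m j)))
instance [∀ i, Nonempty (X i)] : Nonempty (State X) :=
  inferInstanceAs (Nonempty ((i : Fin m) → X (Fin.castAdd q i)))
instance [∀ i, Nonempty (X i)] : Nonempty (Action X) :=
  inferInstanceAs (Nonempty ((j : Fin q) → X (Fin.natAdd m j)))
instance : MeasurableSpace (State X) := ⊤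
instance : MeasurableSpace (Action X) := ⊤
instance : DiscreteMeasurableSpace (State X) := ⟨fun _ => trivial⟩
instance : DiscreteMeasurableSpace (Action X) := ⟨fun _ => trivial⟩

end Spaces

/-- A factored MDP with the normal factored structure given by the components `X`, the transition
scopes `ZP` and the reward scopes `ZR`. The reward components are stochastic: `reward i z` is the
law of the `i`-th reward component when its scope variable equals `z`. -/
structure FMDP {m q l : ℕ} (X : Fin (m + q) → Type u) [∀ i, Fintype (X i)]
    (ZP : Fin m → Finset (Fin (m + q))) (ZR : Fin l → Finset (Fin (m + q))) where
  /-- the transition `P_i(· | x[ZP i])` of the `i`-th state component -/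
  trans : (i : Fin m) → Scope X (ZP i) → stdSimplex ℝ (X (Fin.castAdd q i))
  /-- the law of the `i`-th reward component given `x[ZR i]` -/
  reward : (i : Fin l) → Scope X (ZR i) → ProbabilityMeasure ℝ
  /-- each reward component lies in `[0, 1]` -/
  reward_mem : ∀ i z, ∀ᵐ y ∂(reward i z : Measure ℝ), y ∈ Set.Icc (0 : ℝ) 1
  /-- the total reward (the sum of the independent components) lies in `[0, 1]` -/
  total_mem : ∀ x : (i : Fin (m + q)) → X i,
    ∀ᵐ y ∂(Measure.pi fun i => (reward i (scopeVar (ZR i) x) : Measure ℝ)),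
      ∑ i, y i ∈ Set.Icc (0 : ℝ) 1

section Policies

variable {m q : ℕ}

/-- Stochastic (Markov, step-dependent) policies: `π h s` is the distribution of the action in
state `s` at step `h`. -/
abbrev Policy (X : Fin (m + q) → Type u) [∀ i, Fintype (X i)] (H : ℕ) : Type u :=
  Fin H → State X → stdSimplex ℝ (Action X)

/-- What is observed in an episode: the states `s_1, …, s_{H+1}`, the actions `a_1, …, a_H` and
the vectors of the `l` reward components at the steps `1, …, H`. -/
abbrev Episode (X : Fin (m + q) → Type u) (l H : ℕ) : Type u :=
  (Fin (H + 1) → State X) × (Fin H → Action X) × (Fin H → Fin l → ℝ)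

/-- The history of `k` episodes: in each of them, the policy that was used and what was
observed. -/
abbrev History (X : Fin (m + q) → Type u) [∀ i, Fintype (X i)] (l H k : ℕ) : Type u :=
  Fin k → Policy X H × Episode X l H

/-- A (possibly randomized) learning algorithm: after every number `k` of episodes it draws the
policy of the next episode from a distribution that depends (measurably) on the history.
It sees neither the transitions nor the reward laws. Since the history records the policies drawn
before, this includes algorithms with internal randomness that persists between episodes. -/
structure Algorithm (X : Fin (m + q) → Type u) [∀ i, Fintype (X i)] (l H : ℕ) where
  next : (k : ℕ) → Kernel (History X l H k) (Policy X H)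
  markov : ∀ k, IsMarkovKernel (next k)

end Policies

namespace FMDP

variable {m q l H : ℕ} {X : Fin (m + q) → Type u} [∀ i, Fintype (X i)]
  {ZP : Fin m → Finset (Fin (m + q))} {ZR : Fin l → Finset (Fin (m + q))}

/-- The transition probability `P(s' | s, a) = ∏ i, P_i(s'[i] | x[ZP i])` with `x = (s, a)`. -/
def transProb (M : FMDP X ZP ZR) (s : State X) (a : Action X) (s' : State X) : ℝ :=
  ∏ i, (M.trans i (scopeVar (ZP i) (pair s a))).1 (s' i)

/-- The joint law of the `l` independent reward components at `x = (s, a)`. -/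
noncomputable def rewardLaw (M : FMDP X ZP ZR) (s : State X) (a : Action X) :
    Measure (Fin l → ℝ) :=
  Measure.pi fun i => (M.reward i (scopeVar (ZR i) (pair s a)) : Measure ℝ)

/-- The probability that, under the policy `π`, an episode has states `σ` and actions `α`, given
that its initial state is `σ 0`. -/
def pathProb (M : FMDP X ZP ZR) (π : Policy X H) (σ : Fin (H + 1) → State X)
    (α : Fin H → Action X) : ℝ :=
  ∏ h : Fin H, ((π h (σ h.castSucc)).1 (α h) * M.transProb (σ h.castSucc) (α h) (σ h.succ))

/-- The law of an episode with initial state `s` under the policy `π`: the states and the actions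
follow `pathProb`, and given them the rewards of the steps are independent, those of step `h`
having law `rewardLaw` at `(s_h, a_h)`. -/
noncomputable def episodeLaw (M : FMDP X ZP ZR) (s : State X) (π : Policy X H) :
    Measure (Episode X l H) :=
  ∑ τ : (Fin H → State X) × (Fin H → Action X),
    let σ : Fin (H + 1) → State X := Fin.cons s τ.1
    ENNReal.ofReal (M.pathProb π σ τ.2) •
      (Measure.dirac σ).prod ((Measure.dirac τ.2).prod
        (Measure.pi fun h : Fin H => M.rewardLaw (σ h.castSucc) (τ.2 h)))

/-- The value `V_1^π(s)`: the expected total reward of an episode that starts in `s`. -/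
noncomputable def value (M : FMDP X ZP ZR) (π : Policy X H) (s : State X) : ℝ :=
  ∫ e, ∑ h : Fin H, ∑ i : Fin l, e.2.2 h i ∂(M.episodeLaw s π)

/-- The optimal value `V_1^*(s)` for horizon `H`. -/
noncomputable def optValue (M : FMDP X ZP ZR) (H : ℕ) (s : State X) : ℝ :=
  ⨆ π : Policy X H, M.value π s

lemma transProb_nonneg (M : FMDP X ZP ZR) (s : State X) (a : Action X) (s' : State X) :
    0 ≤ M.transProb s a s' :=
  Finset.prod_nonneg fun i _ => (M.trans i _).2.1 _

lemma sum_transProb (M : FMDP X ZP ZR) (s : State X) (a : Action X) :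
    ∑ s', M.transProb s a s' = 1 := by
  have h := Finset.prod_univ_sum (fun i : Fin m => (Finset.univ : Finset (X (Fin.castAdd q i))))
    (fun i y => (M.trans i (scopeVar (ZP i) (pair s a))).1 y)
  rw [Fintype.piFinset_univ] at h
  refine h.symm.trans ?_
  exact Finset.prod_eq_one fun i _ => (M.trans i _).2.2

lemma pathProb_nonneg (M : FMDP X ZP ZR) (π : Policy X H) (σ : Fin (H + 1) → State X)
    (α : Fin H → Action X) : 0 ≤ M.pathProb π σ α :=
  Finset.prod_nonneg fun h _ => mul_nonneg ((π h _).2.1 _) (M.transProb_nonneg _ _ _)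

lemma sum_pathProb (M : FMDP X ZP ZR) (π : Policy X H) (s : State X) :
    ∑ τ : (Fin H → State X) × (Fin H → Action X),
      M.pathProb π (Fin.cons s τ.1 : Fin (H + 1) → State X) τ.2 = 1 := by
  induction H generalizing s with
  | zero => simp [pathProb]
  | succ H ih =>
    have key : ∀ (s' : State X) (σ : Fin H → State X) (a : Action X) (α : Fin H → Action X),
        M.pathProb π (Fin.cons s (Fin.cons s' σ : Fin (H + 1) → State X) :
            Fin (H + 1 + 1) → State X) (Fin.cons a α : Fin (H + 1) → Action X)
          = ((π 0 s).1 a * M.transProb s a s') *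
            M.pathProb (fun h => π h.succ) (Fin.cons s' σ : Fin (H + 1) → State X) α := by
      intro s' σ a α
      simp [pathProb, Fin.prod_univ_succ]
    have e := Fintype.sum_equiv
      ((Equiv.prodProdProdComm (State X) (Action X) (Fin H → State X) (Fin H → Action X)).trans
        (Equiv.prodCongr (Fin.consEquiv fun _ : Fin (H + 1) => State X)
          (Fin.consEquiv fun _ : Fin (H + 1) => Action X)))
      (fun p => ((π 0 s).1 p.1.2 * M.transProb s p.1.2 p.1.1) *
            M.pathProb (fun h => π h.succ) (Fin.cons p.1.1 p.2.1 : Fin (H + 1) → State X) p.2.2)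
      (fun τ => M.pathProb π (Fin.cons s τ.1 : Fin (H + 1 + 1) → State X) τ.2)
      (fun p => (key p.1.1 p.2.1 p.1.2 p.2.2).symm)
    rw [← e, Fintype.sum_prod_type]
    simp_rw [← Finset.mul_sum, ih, mul_one]
    rw [Fintype.sum_prod_type_right]
    simp_rw [← Finset.mul_sum, sum_transProb, mul_one]
    exact (π 0 s).2.2

instance (M : FMDP X ZP ZR) (s : State X) (a : Action X) :
    IsProbabilityMeasure (M.rewardLaw s a) := by
  unfold rewardLaw; infer_instance

instance (M : FMDP X ZP ZR) (s : State X) (π : Policy X H) :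
    IsProbabilityMeasure (M.episodeLaw s π) := by
  constructor
  simp only [episodeLaw, Measure.coe_finsetSum, Finset.sum_apply, Measure.smul_apply,
    measure_univ, smul_eq_mul, mul_one]
  rw [← ENNReal.ofReal_sum_of_nonneg fun _ _ => M.pathProb_nonneg _ _ _, M.sum_pathProb,
    ENNReal.ofReal_one]

lemma measurable_episodeLaw (M : FMDP X ZP ZR) (s : State X) :
    Measurable fun π : Policy X H => M.episodeLaw s π := by
  refine Measure.measurable_of_measurable_coe _ fun t _ => ?_
  simp only [episodeLaw, Measure.coe_finsetSum, Finset.sum_apply, Measure.smul_apply, smul_eq_mul]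
  refine Finset.measurable_sum _ fun τ _ => Measurable.mul_const ?_ _
  refine ENNReal.measurable_ofReal.comp (Finset.measurable_prod _ fun h _ => ?_)
  refine Measurable.mul_const ?_ _
  exact (measurable_pi_apply _).comp (measurable_subtype_coe.comp
    ((measurable_pi_apply _).comp (measurable_pi_apply h)))

/-- `episodeLaw` as a Markov kernel from policies to episodes. -/
noncomputable def episodeKernel (M : FMDP X ZP ZR) (s : State X) :
    Kernel (Policy X H) (Episode X l H) :=
  ⟨fun π => M.episodeLaw s π, M.measurable_episodeLaw s⟩

instance (M : FMDP X ZP ZR) (s : State X) : IsMarkovKernel (M.episodeKernel (H := H) s) :=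
  ⟨fun π => inferInstanceAs (IsProbabilityMeasure (M.episodeLaw s π))⟩

/-- The law of the history of the first `k` episodes when the algorithm `alg` interacts with `M`
and the successive episodes start in `s₁ 0, s₁ 1, …`. -/
noncomputable def historyLaw (M : FMDP X ZP ZR) (alg : Algorithm X l H) (s₁ : ℕ → State X) :
    (k : ℕ) → Measure (History X l H k)
  | 0 => Measure.dirac Fin.elim0
  | k + 1 =>
    ((M.historyLaw alg s₁ k) ⊗ₘ
        ((alg.next k) ⊗ₖ (Kernel.prodMkLeft (History X l H k) (M.episodeKernel (s₁ k))))).map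
      fun p => (Fin.snoc p.1 p.2 : History X l H (k + 1))

/-- The expected regret in `K` episodes: the expectation of
`∑ k, (V_1^*(s_{k,1}) - V_1^{π_k}(s_{k,1}))`, where `π_k` is the policy used in episode `k`. -/
noncomputable def expectedRegret (M : FMDP X ZP ZR) (alg : Algorithm X l H) (s₁ : ℕ → State X)
    (K : ℕ) : ℝ :=
  ∫ w, ∑ k : Fin K, (M.optValue H (s₁ k) - M.value (w k).1 (s₁ k)) ∂(M.historyLaw alg s₁ K)

end FMDP

end FactoredMDP

open FactoredMDP

/-! Since a reward scope consists of action components only, one action can fix its scope variable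
in every state. Thus a single reward component turns the FMDP into a bandit with `N = scopeCard X
(ZR i₀)` arms and `T = K * H` pulls, and the transitions play no role. All other reward components
are set to zero, and `i₀` is chosen with the largest scope.

In the fair problem every arm has a Bernoulli reward of mean `1/2`; in the problem of arm `z` its
mean is raised to `1/2 + ε`. The transitions agree, so the history laws differ by the density `exp
Λ`, where `Λ` is the sum of the reward log-likelihood ratios (`historyLaw_withDensity`). The
divergence of the fair history law from that of arm `z` is `bernoulliDiv ε ≤ 4 * ε ^ 2` times the
expected pulls of `z` in the fair problem. By `integral_withDensity_exp_le`, the expected pulls of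
`z` in its own problem exceed those in the fair one by at most `T * (8 * divergence + 1/8)`.

In the fair problem the expected pulls sum to `T` over the arms (`sum_pulls`). Averaging over `z`
with `ε = √(N / T) / 16` yields an arm pulled at most `7/8 * T` times in its own problem. Each other
pull costs `ε`, so the regret is at least `ε * T / 8 = √(N * T) / 128`.

Pulls are counted by their conditional expectations given the policies. These are the same function
of the history in all the problems, and the value of a policy is affine in them. -/

namespace FactoredMDP

/-! ### Densities of product measures. -/

/-- A product of probability measures with densities has the product density. -/
lemma pi_withDensity {ι : Type*} [Fintype ι] {α : ι → Type*} [∀ i, MeasurableSpace (α i)]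
    (μ : (i : ι) → Measure (α i)) [∀ i, IsProbabilityMeasure (μ i)]
    (f : (i : ι) → α i → ℝ≥0∞) (hf : ∀ i, Measurable (f i))
    [∀ i, SigmaFinite ((μ i).withDensity (f i))] :
    Measure.pi (fun i => (μ i).withDensity (f i)) =
      (Measure.pi μ).withDensity fun x => ∏ i, f i (x i) := by
  refine Measure.pi_eq fun s hs => ?_
  -- The indicator of a box factors over the coordinates, so the integral of the density over the
  -- box is the expectation of a product of independent variables.
  have hind := (iIndepFun_pi (μ := μ) (X := fun i => (s i).indicator (f i))
    fun i => ((hf i).indicator (hs i)).aemeasurable)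
  rw [withDensity_apply _ (MeasurableSet.univ_pi hs),
    ← lintegral_indicator (MeasurableSet.univ_pi hs)]
  have h := lintegral_prod_eq_prod_lintegral_of_indepFun Finset.univ _ hind
    fun i => ((hf i).indicator (hs i)).comp (measurable_pi_apply i)
  calc _ = ∫⁻ x, ∏ i, (s i).indicator (f i) (x i) ∂Measure.pi μ := by
        refine lintegral_congr fun x => ?_
        classical
        by_cases hx : x ∈ Set.univ.pi s
        · rw [Set.indicator_of_mem hx]
          exact Finset.prod_congr rfl fun i _ => (Set.indicator_of_mem (hx i trivial) _).symm
        · rw [Set.indicator_of_notMem hx]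
          simp only [Set.mem_pi, Set.mem_univ, true_imp_iff, not_forall] at hx
          obtain ⟨i, hi⟩ := hx
          exact (Finset.prod_eq_zero (Finset.mem_univ i) (Set.indicator_of_notMem hi _)).symm
    _ = ∏ i, ∫⁻ x, (s i).indicator (f i) (x i) ∂Measure.pi μ := h
    _ = _ := by
        refine Finset.prod_congr rfl fun i _ => ?_
        rw [withDensity_apply _ (hs i), ← lintegral_indicator (hs i),
          ← (measurePreserving_eval μ i).lintegral_comp ((hf i).indicator (hs i))]

/-! ### Expectations over a single episode. -/

namespace FMDP

variable {m q l H : ℕ} {X : Fin (m + q) → Type u} [∀ i, Fintype (X i)]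
  {ZP : Fin m → Finset (Fin (m + q))} {ZR : Fin l → Finset (Fin (m + q))}

/-- The expectation of `f` over the states and actions of an episode. -/
noncomputable def pathExp (M : FMDP X ZP ZR) (s : State X) (π : Policy X H)
    (f : (Fin (H + 1) → State X) → (Fin H → Action X) → ℝ) : ℝ :=
  ∑ τ : (Fin H → State X) × (Fin H → Action X),
    M.pathProb π (Fin.cons s τ.1) τ.2 * f (Fin.cons s τ.1) τ.2

lemma pathExp_mono (M : FMDP X ZP ZR) (s : State X) (π : Policy X H)
    {f g : (Fin (H + 1) → State X) → (Fin H → Action X) → ℝ} (h : ∀ σ α, f σ α ≤ g σ α) :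
    M.pathExp s π f ≤ M.pathExp s π g :=
  Finset.sum_le_sum fun _ _ => mul_le_mul_of_nonneg_left (h _ _) (M.pathProb_nonneg _ _ _)

lemma pathExp_const (M : FMDP X ZP ZR) (s : State X) (π : Policy X H) (c : ℝ) :
    M.pathExp s π (fun _ _ => c) = c := by
  simp only [pathExp, ← Finset.sum_mul, M.sum_pathProb, one_mul]

lemma pathExp_add (M : FMDP X ZP ZR) (s : State X) (π : Policy X H)
    (f g : (Fin (H + 1) → State X) → (Fin H → Action X) → ℝ) :
    M.pathExp s π (fun σ α => f σ α + g σ α) = M.pathExp s π f + M.pathExp s π g := by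
  simp only [pathExp, mul_add, Finset.sum_add_distrib]

lemma pathExp_mul (M : FMDP X ZP ZR) (s : State X) (π : Policy X H) (c : ℝ)
    (f : (Fin (H + 1) → State X) → (Fin H → Action X) → ℝ) :
    M.pathExp s π (fun σ α => c * f σ α) = c * M.pathExp s π f := by
  simp only [pathExp, Finset.mul_sum]
  exact Finset.sum_congr rfl fun _ _ => by ring

lemma pathExp_sum (M : FMDP X ZP ZR) (s : State X) (π : Policy X H) {ι : Type*} (t : Finset ι)
    (f : ι → (Fin (H + 1) → State X) → (Fin H → Action X) → ℝ) :
    M.pathExp s π (fun σ α => ∑ i ∈ t, f i σ α) = ∑ i ∈ t, M.pathExp s π (f i) := by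
  simp only [pathExp, Finset.mul_sum]
  exact Finset.sum_comm

lemma measurable_pathExp (M : FMDP X ZP ZR) (s : State X)
    (f : (Fin (H + 1) → State X) → (Fin H → Action X) → ℝ) :
    Measurable fun π : Policy X H => M.pathExp s π f := by
  refine Finset.measurable_sum _ fun τ _ => Measurable.mul_const ?_ _
  refine Finset.measurable_prod _ fun h _ => Measurable.mul_const ?_ _
  exact (measurable_pi_apply _).comp (measurable_subtype_coe.comp
    ((measurable_pi_apply _).comp (measurable_pi_apply h)))

/-- An episode law is a mixture of the laws of the rewards along the possible paths. -/
lemma episodeLaw_eq_sum_map (M : FMDP X ZP ZR) (s : State X) (π : Policy X H) :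
    M.episodeLaw s π = ∑ τ : (Fin H → State X) × (Fin H → Action X),
      ENNReal.ofReal (M.pathProb π (Fin.cons s τ.1) τ.2) •
        (Measure.pi fun h : Fin H =>
          M.rewardLaw ((Fin.cons s τ.1 : Fin (H + 1) → State X) h.castSucc) (τ.2 h)).map
          fun r => ((Fin.cons s τ.1 : Fin (H + 1) → State X), τ.2, r) := by
  refine Finset.sum_congr rfl fun τ _ => ?_
  dsimp only
  rw [Measure.dirac_prod, Measure.dirac_prod, Measure.map_map (by fun_prop) (by fun_prop)]
  rfl

lemma lintegral_episodeLaw (M : FMDP X ZP ZR) (s : State X) (π : Policy X H)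
    {f : Episode X l H → ℝ≥0∞} (hf : Measurable f) :
    ∫⁻ e, f e ∂M.episodeLaw s π = ∑ τ : (Fin H → State X) × (Fin H → Action X),
      ENNReal.ofReal (M.pathProb π (Fin.cons s τ.1) τ.2) *
        ∫⁻ r, f (Fin.cons s τ.1, τ.2, r) ∂(Measure.pi fun h : Fin H =>
          M.rewardLaw ((Fin.cons s τ.1 : Fin (H + 1) → State X) h.castSucc) (τ.2 h)) := by
  rw [episodeLaw_eq_sum_map, lintegral_finsetSum_measure]
  refine Finset.sum_congr rfl fun τ _ => ?_
  rw [lintegral_smul_measure, lintegral_map hf (by fun_prop), smul_eq_mul]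

/-- The expectation of an additive functional of the steps of an episode. -/
lemma integral_episodeLaw_sum (M : FMDP X ZP ZR) (s : State X) (π : Policy X H)
    (G : State X → Action X → (Fin l → ℝ) → ℝ)
    (hG : ∀ s a, Integrable (G s a) (M.rewardLaw s a)) :
    ∫ e, ∑ h : Fin H, G (e.1 h.castSucc) (e.2.1 h) (e.2.2 h) ∂M.episodeLaw s π =
      M.pathExp s π fun σ α => ∑ h : Fin H, ∫ y, G (σ h.castSucc) (α h) y
        ∂M.rewardLaw (σ h.castSucc) (α h) := by
  -- Integrals transfer along a measurable embedding without any joint measurability of `G` in path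
  -- and rewards.
  have hemb : ∀ (σ : Fin (H + 1) → State X) (α : Fin H → Action X), MeasurableEmbedding
      fun r : Fin H → Fin l → ℝ => (σ, α, r) := fun σ α =>
    (measurableEmbedding_prodMk_left σ).comp (measurableEmbedding_prodMk_left α)
  have hint : ∀ (σ : Fin (H + 1) → State X) (α : Fin H → Action X) (h : Fin H),
      Integrable (fun r : Fin H → Fin l → ℝ => G (σ h.castSucc) (α h) (r h))
        (Measure.pi fun h : Fin H => M.rewardLaw (σ h.castSucc) (α h)) := fun σ α h =>
    integrable_comp_eval (μ := fun h : Fin H => M.rewardLaw (σ h.castSucc) (α h)) (hG _ _)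
  rw [episodeLaw_eq_sum_map, integral_finsetSum_measure]
  · refine Finset.sum_congr rfl fun τ _ => ?_
    rw [integral_smul_measure, (hemb _ _).integral_map,
      ENNReal.toReal_ofReal (M.pathProb_nonneg _ _ _), smul_eq_mul,
      integral_finsetSum _ fun h _ => hint _ _ h]
    congr 1
    refine Finset.sum_congr rfl fun h _ => ?_
    exact integral_comp_eval (μ := fun h : Fin H => M.rewardLaw
      ((Fin.cons s τ.1 : Fin (H + 1) → State X) h.castSucc) (τ.2 h)) (hG _ _).aestronglyMeasurable
  · refine fun τ _ => Integrable.smul_measure ?_ ENNReal.ofReal_ne_top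
    rw [(hemb _ _).integrable_map_iff]
    exact integrable_finsetSum _ fun h _ => hint _ _ h

end FMDP

end FactoredMDP

/-! ### Additive reward functionals and the change of measure within an episode. -/

namespace FactoredMDP

variable {m q l H : ℕ} {X : Fin (m + q) → Type u}

/-- The sum over the steps and the reward components of an episode of functions `g i z` of the
`i`-th reward component, where `z` is the value of its scope variable. -/
def rewardSum (ZR : Fin l → Finset (Fin (m + q))) (g : (i : Fin l) → Scope X (ZR i) → ℝ → ℝ)
    (e : Episode X l H) : ℝ :=
  ∑ h : Fin H, ∑ i, g i (scopeVar (ZR i) (pair (e.1 h.castSucc) (e.2.1 h))) (e.2.2 h i)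

lemma abs_rewardSum_le {ZR : Fin l → Finset (Fin (m + q))}
    {g : (i : Fin l) → Scope X (ZR i) → ℝ → ℝ} {C : ℝ} (hC : ∀ i z y, |g i z y| ≤ C)
    (e : Episode X l H) : |rewardSum ZR g e| ≤ H * (l * C) := by
  refine (Finset.abs_sum_le_sum_abs _ _).trans ?_
  refine (Finset.sum_le_card_nsmul _ _ (l * C) fun h _ => ?_).trans (by simp)
  refine (Finset.abs_sum_le_sum_abs _ _).trans ?_
  exact (Finset.sum_le_card_nsmul _ _ C fun i _ => hC _ _ _).trans (by simp)

variable [∀ i, Fintype (X i)] {ZP : Fin m → Finset (Fin (m + q))}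
  {ZR : Fin l → Finset (Fin (m + q))} {g : (i : Fin l) → Scope X (ZR i) → ℝ → ℝ}

lemma measurable_rewardSum (hg : ∀ i z, Measurable (g i z)) :
    Measurable (rewardSum (H := H) ZR g) := by
  refine Finset.measurable_sum _ fun h _ => Finset.measurable_sum _ fun i _ => ?_
  have key : Measurable fun p : (State X × Action X) × ℝ =>
      g i (scopeVar (ZR i) (pair p.1.1 p.1.2)) p.2 :=
    measurable_from_prod_countable_right fun p => hg i (scopeVar (ZR i) (pair p.1 p.2))
  have hp : Measurable fun e : Episode X l H =>
      (((e.1 h.castSucc, e.2.1 h), e.2.2 h i) : (State X × Action X) × ℝ) := by fun_prop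
  exact key.comp hp

namespace FMDP

lemma transProb_congr {M₀ M : FMDP X ZP ZR} (ht : M.trans = M₀.trans) :
    M.transProb = M₀.transProb := by
  unfold transProb; rw [ht]

lemma pathProb_congr {M₀ M : FMDP X ZP ZR} (ht : M.trans = M₀.trans) (π : Policy X H) :
    M.pathProb π = M₀.pathProb π := by
  unfold pathProb; rw [transProb_congr ht]

lemma pathExp_congr {M₀ M : FMDP X ZP ZR} (ht : M.trans = M₀.trans) (s : State X)
    (π : Policy X H) : M.pathExp s π = M₀.pathExp s π := by
  unfold pathExp; rw [pathProb_congr ht]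

lemma rewardLaw_withDensity {M₀ M : FMDP X ZP ZR} (hg : ∀ i z, Measurable (g i z))
    (hr : ∀ i z, (M.reward i z : Measure ℝ) =
      (M₀.reward i z : Measure ℝ).withDensity fun y => ENNReal.ofReal (Real.exp (g i z y)))
    (s : State X) (a : Action X) :
    M.rewardLaw s a = (M₀.rewardLaw s a).withDensity fun y =>
      ∏ i, ENNReal.ofReal (Real.exp (g i (scopeVar (ZR i) (pair s a)) (y i))) := by
  have hfin : ∀ i, IsProbabilityMeasure ((M₀.reward i (scopeVar (ZR i) (pair s a)) :
      Measure ℝ).withDensity fun y =>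
        ENNReal.ofReal (Real.exp (g i (scopeVar (ZR i) (pair s a)) y))) := fun i => by
    rw [← hr]; infer_instance
  unfold rewardLaw
  simp_rw [hr]
  exact pi_withDensity _ _ fun i => ((hg _ _).exp).ennreal_ofReal

/-- Path probabilities depend only on the policy and the transitions, which agree. Only the rewards
contribute to the density, and their logarithms add over steps and components. -/
lemma episodeLaw_withDensity {M₀ M : FMDP X ZP ZR} (hg : ∀ i z, Measurable (g i z))
    (ht : M.trans = M₀.trans)
    (hr : ∀ i z, (M.reward i z : Measure ℝ) =
      (M₀.reward i z : Measure ℝ).withDensity fun y => ENNReal.ofReal (Real.exp (g i z y)))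
    (s : State X) (π : Policy X H) :
    M.episodeLaw s π = (M₀.episodeLaw s π).withDensity fun e =>
      ENNReal.ofReal (Real.exp (rewardSum ZR g e)) := by
  have hL : Measurable fun e : Episode X l H => ENNReal.ofReal (Real.exp (rewardSum ZR g e)) :=
    (measurable_rewardSum hg).exp.ennreal_ofReal
  refine Measure.ext_of_lintegral _ fun f hf => ?_
  rw [lintegral_withDensity_eq_lintegral_mul _ hL hf, lintegral_episodeLaw _ _ _ hf,
    lintegral_episodeLaw _ _ _ (hL.mul hf), pathProb_congr ht]
  refine Finset.sum_congr rfl fun τ _ => ?_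
  congr 1
  have hG : ∀ (s : State X) (a : Action X), Measurable fun y : Fin l → ℝ =>
      ∏ i, ENNReal.ofReal (Real.exp (g i (scopeVar (ZR i) (pair s a)) (y i))) := fun s a =>
    Finset.measurable_prod _ fun i _ =>
      ((hg _ _).comp (measurable_pi_apply i)).exp.ennreal_ofReal
  have hfin : ∀ (s : State X) (a : Action X), IsProbabilityMeasure ((M₀.rewardLaw s a).withDensity
      fun y => ∏ i, ENNReal.ofReal (Real.exp (g i (scopeVar (ZR i) (pair s a)) (y i)))) :=
    fun s a => by rw [← rewardLaw_withDensity hg hr]; infer_instance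
  simp_rw [rewardLaw_withDensity hg hr]
  have hfr : Measurable fun r : Fin H → Fin l → ℝ =>
      f ((Fin.cons s τ.1 : Fin (H + 1) → State X), τ.2, r) := hf.comp (by fun_prop)
  rw [pi_withDensity _ _ fun h => hG _ _]
  refine (lintegral_withDensity_eq_lintegral_mul _
    (Finset.measurable_prod _ fun h _ => (hG _ _).comp (measurable_pi_apply h)) hfr).trans ?_
  refine lintegral_congr fun r => ?_
  simp only [Pi.mul_apply, rewardSum, Real.exp_sum]
  rw [ENNReal.ofReal_prod_of_nonneg fun _ _ => Finset.prod_nonneg fun _ _ => (Real.exp_pos _).le]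
  simp_rw [ENNReal.ofReal_prod_of_nonneg fun _ _ => (Real.exp_pos _).le]
  rfl

lemma integrable_of_abs_le {Ω : Type*} [MeasurableSpace Ω] {μ : Measure Ω} [IsFiniteMeasure μ]
    {f : Ω → ℝ} (hf : Measurable f) {C : ℝ} (hC : ∀ x, |f x| ≤ C) : Integrable f μ :=
  Integrable.of_bound hf.aestronglyMeasurable C (Filter.Eventually.of_forall hC)

/-- The expectation of a sum of functions of the reward components. -/
lemma integral_rewardSum (M : FMDP X ZP ZR) (s : State X) (π : Policy X H)
    (hg : ∀ i z, Integrable (g i z) (M.reward i z : Measure ℝ)) :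
    ∫ e, rewardSum ZR g e ∂M.episodeLaw s π = M.pathExp s π fun σ α =>
      ∑ h : Fin H, ∑ i, ∫ y, g i (scopeVar (ZR i) (pair (σ h.castSucc) (α h))) y
        ∂(M.reward i (scopeVar (ZR i) (pair (σ h.castSucc) (α h))) : Measure ℝ) := by
  have hint : ∀ (s : State X) (a : Action X) (i : Fin l), Integrable
      (fun y : Fin l → ℝ => g i (scopeVar (ZR i) (pair s a)) (y i)) (M.rewardLaw s a) :=
    fun s a i => integrable_comp_eval
      (μ := fun i => (M.reward i (scopeVar (ZR i) (pair s a)) : Measure ℝ)) (hg _ _)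
  unfold rewardSum
  rw [integral_episodeLaw_sum M s π
    (fun s a y => ∑ i, g i (scopeVar (ZR i) (pair s a)) (y i))
    fun s a => integrable_finsetSum _ fun i _ => hint s a i]
  congr 1
  ext σ α
  refine Finset.sum_congr rfl fun h _ => ?_
  rw [integral_finsetSum _ fun i _ => hint _ _ i]
  exact Finset.sum_congr rfl fun i _ => integral_comp_eval
    (μ := fun i => (M.reward i (scopeVar (ZR i) (pair (σ h.castSucc) (α h))) : Measure ℝ))
    (hg _ _).aestronglyMeasurable

end FMDP

end FactoredMDP

/-! ### History laws: change of measure and conditioning on the policies. -/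

namespace FactoredMDP

variable {m q l H : ℕ} {X : Fin (m + q) → Type u} [∀ i, Fintype (X i)]
  {ZP : Fin m → Finset (Fin (m + q))}
  {ZR : Fin l → Finset (Fin (m + q))} {g : (i : Fin l) → Scope X (ZR i) → ℝ → ℝ}

lemma measurable_snoc (k : ℕ) : Measurable
    fun p : History X l H k × (Policy X H × Episode X l H) =>
      (Fin.snoc p.1 p.2 : History X l H (k + 1)) := by
  refine measurable_pi_iff.2 fun i => ?_
  refine Fin.lastCases ?_ (fun j => ?_) i
  · simpa only [Fin.snoc_last] using measurable_snd
  · simp only [Fin.snoc_castSucc]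
    exact (measurable_pi_apply j).comp measurable_fst

instance (alg : Algorithm X l H) (k : ℕ) : IsMarkovKernel (alg.next k) := alg.markov k

namespace FMDP

/-- The law of the policy and the observations of episode `k`, given the history before it. -/
noncomputable def roundKernel (M : FMDP X ZP ZR) (alg : Algorithm X l H) (s₁ : ℕ → State X)
    (k : ℕ) : Kernel (History X l H k) (Policy X H × Episode X l H) :=
  (alg.next k) ⊗ₖ (Kernel.prodMkLeft (History X l H k) (M.episodeKernel (s₁ k)))

instance (M : FMDP X ZP ZR) (alg : Algorithm X l H) (s₁ : ℕ → State X) (k : ℕ) :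
    IsMarkovKernel (M.roundKernel alg s₁ k) := by
  unfold roundKernel; infer_instance

instance (M : FMDP X ZP ZR) (alg : Algorithm X l H) (s₁ : ℕ → State X) (k : ℕ) :
    IsProbabilityMeasure (M.historyLaw alg s₁ k) := by
  induction k with
  | zero => exact inferInstanceAs (IsProbabilityMeasure (Measure.dirac _))
  | succ k ih =>
    exact Measure.isProbabilityMeasure_map (μ := M.historyLaw alg s₁ k ⊗ₘ M.roundKernel alg s₁ k)
      (measurable_snoc k).aemeasurable

lemma historyLaw_succ (M : FMDP X ZP ZR) (alg : Algorithm X l H) (s₁ : ℕ → State X) (k : ℕ) :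
    M.historyLaw alg s₁ (k + 1) =
      (M.historyLaw alg s₁ k ⊗ₘ M.roundKernel alg s₁ k).map
        fun p => (Fin.snoc p.1 p.2 : History X l H (k + 1)) := rfl

lemma lintegral_roundKernel (M : FMDP X ZP ZR) (alg : Algorithm X l H) (s₁ : ℕ → State X) (k : ℕ)
    (w : History X l H k) {f : Policy X H × Episode X l H → ℝ≥0∞} (hf : Measurable f) :
    ∫⁻ p, f p ∂M.roundKernel alg s₁ k w =
      ∫⁻ π, ∫⁻ e, f (π, e) ∂M.episodeLaw (s₁ k) π ∂alg.next k w :=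
  Kernel.lintegral_compProd _ _ _ hf

lemma lintegral_historyLaw_succ (M : FMDP X ZP ZR) (alg : Algorithm X l H) (s₁ : ℕ → State X)
    (k : ℕ) {f : History X l H (k + 1) → ℝ≥0∞} (hf : Measurable f) :
    ∫⁻ w, f w ∂M.historyLaw alg s₁ (k + 1) =
      ∫⁻ w, ∫⁻ p, f (Fin.snoc w p) ∂M.roundKernel alg s₁ k w ∂M.historyLaw alg s₁ k := by
  rw [historyLaw_succ, lintegral_map hf (measurable_snoc k)]
  exact Measure.lintegral_compProd (hf.comp (measurable_snoc k))

/-- Additive functional of the episodes of a history. -/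
lemma sum_snoc {k : ℕ} (w : History X l H k) (p : Policy X H × Episode X l H)
    (F : Policy X H × Episode X l H → ℝ) :
    ∑ j, F ((Fin.snoc w p : History X l H (k + 1)) j) = ∑ j, F (w j) + F p := by
  simp [Fin.sum_univ_castSucc]

/-- Change of measure between two FMDPs with the same transitions, whose reward laws have the
log-likelihood ratios `g`. -/
lemma historyLaw_withDensity {M₀ M : FMDP X ZP ZR} (hg : ∀ i z, Measurable (g i z))
    (ht : M.trans = M₀.trans)
    (hr : ∀ i z, (M.reward i z : Measure ℝ) =
      (M₀.reward i z : Measure ℝ).withDensity fun y => ENNReal.ofReal (Real.exp (g i z y)))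
    (alg : Algorithm X l H) (s₁ : ℕ → State X) (k : ℕ) :
    M.historyLaw alg s₁ k = (M₀.historyLaw alg s₁ k).withDensity fun w =>
      ENNReal.ofReal (Real.exp (∑ j, rewardSum ZR g (w j).2)) := by
  have hE : Measurable fun e : Episode X l H => ENNReal.ofReal (Real.exp (rewardSum ZR g e)) :=
    (measurable_rewardSum hg).exp.ennreal_ofReal
  have hL : ∀ k, Measurable fun w : History X l H k =>
      ENNReal.ofReal (Real.exp (∑ j, rewardSum ZR g (w j).2)) := fun k =>
    (Finset.measurable_sum _ fun j _ => (measurable_rewardSum hg).comp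
      (measurable_snd.comp (measurable_pi_apply j))).exp.ennreal_ofReal
  induction k with
  | zero => simp [historyLaw]
  | succ k ih =>
    refine Measure.ext_of_lintegral _ fun f hf => ?_
    have hf' : Measurable fun p : History X l H k × (Policy X H × Episode X l H) =>
        f (Fin.snoc p.1 p.2) := hf.comp (measurable_snoc k)
    rw [lintegral_withDensity_eq_lintegral_mul _ (hL _) hf, lintegral_historyLaw_succ _ _ _ _ hf,
      lintegral_historyLaw_succ _ _ _ _ ((hL _).mul hf), ih,
      lintegral_withDensity_eq_lintegral_mul _ (hL k) (Measurable.lintegral_kernel_prod_right' hf')]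
    refine lintegral_congr fun w => ?_
    have hw : Measurable fun p : Policy X H × Episode X l H => f (Fin.snoc w p) :=
      hf'.comp measurable_prodMk_left
    have hEw : Measurable fun p : Policy X H × Episode X l H =>
        ENNReal.ofReal (Real.exp (rewardSum ZR g p.2)) * f (Fin.snoc w p) :=
      (hE.comp measurable_snd).mul hw
    -- The log-ratio splits into the past and the new episode. The kernel `alg.next k` is common to
    -- both laws, so it contributes no density.
    simp only [Pi.mul_apply, sum_snoc w _ fun p => rewardSum ZR g p.2, Real.exp_add,
      ENNReal.ofReal_mul (Real.exp_pos _).le, mul_assoc]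
    rw [lintegral_const_mul _ hEw, lintegral_roundKernel _ _ _ _ _ hw,
      lintegral_roundKernel _ _ _ _ _ hEw]
    congr 1
    refine lintegral_congr fun π => ?_
    rw [episodeLaw_withDensity hg ht hr]
    exact lintegral_withDensity_eq_lintegral_mul _ hE (hw.comp measurable_prodMk_left)

/-- The expectation of a sum of functions of the episodes, in terms of the conditional expectations
given the policies. -/
lemma integral_historyLaw_sum (M : FMDP X ZP ZR) (alg : Algorithm X l H) (s : State X)
    {F : Policy X H × Episode X l H → ℝ} (hF : Measurable F) {C : ℝ} (hC : ∀ p, |F p| ≤ C)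
    {F' : Policy X H → ℝ} (hF' : Measurable F')
    (h : ∀ π, ∫ e, F (π, e) ∂M.episodeLaw s π = F' π) (k : ℕ) :
    ∫ w, ∑ j, F (w j) ∂M.historyLaw alg (fun _ => s) k =
      ∫ w, ∑ j, F' (w j).1 ∂M.historyLaw alg (fun _ => s) k := by
  have hC' : ∀ π, |F' π| ≤ C := fun π => by
    rw [← h, ← Real.norm_eq_abs]
    simpa using norm_integral_le_of_norm_le_const (μ := M.episodeLaw s π)
      (f := fun e => F (π, e)) (C := C) (Filter.Eventually.of_forall fun e => hC (π, e))
  have key : ∀ (k : ℕ) (G : Policy X H × Episode X l H → ℝ), Measurable G → (∀ p, |G p| ≤ C) →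
      ∫ w, ∑ j, G (w j) ∂M.historyLaw alg (fun _ => s) (k + 1) =
        ∫ w, ∑ j, G (w j) ∂M.historyLaw alg (fun _ => s) k +
        ∫ w, ∫ π, ∫ e, G (π, e) ∂M.episodeLaw s π ∂alg.next k w
          ∂M.historyLaw alg (fun _ => s) k := by
    intro k G hG hGC
    have h1 : Integrable (fun p : History X l H k × (Policy X H × Episode X l H) =>
        ∑ j, G (p.1 j)) (M.historyLaw alg (fun _ => s) k ⊗ₘ M.roundKernel alg (fun _ => s) k) :=
      integrable_finsetSum _ fun j _ =>
        integrable_of_abs_le (hG.comp ((measurable_pi_apply j).comp measurable_fst)) fun _ => hGC _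
    have h2 : Integrable (fun p : History X l H k × (Policy X H × Episode X l H) => G p.2)
        (M.historyLaw alg (fun _ => s) k ⊗ₘ M.roundKernel alg (fun _ => s) k) :=
      integrable_of_abs_le (hG.comp measurable_snd) fun _ => hGC _
    have hm : Measurable fun w : History X l H (k + 1) => ∑ j, G (w j) :=
      Finset.measurable_sum _ fun j _ => hG.comp (measurable_pi_apply j)
    rw [historyLaw_succ, integral_map (measurable_snoc k).aemeasurable hm.aestronglyMeasurable]
    simp only [sum_snoc]
    rw [integral_add h1 h2, Measure.integral_compProd h1, Measure.integral_compProd h2]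
    congr 1
    · simp
    · refine integral_congr_ae (Filter.Eventually.of_forall fun w => ?_)
      exact integral_compProd (integrable_of_abs_le hG hGC)
  induction k with
  | zero => simp
  | succ k ih =>
    -- The same recursion holds for `F` and for `F'` of the policy. The new terms agree because `F'`
    -- is constant in the episode and `episodeLaw` has mass one.
    rw [key k F hF hC, key k (fun p => F' p.1) (hF'.comp measurable_fst) fun p => hC' p.1, ih]
    simp [h]

end FMDP

/-! ### A transport inequality for bounded functions. -/

/-- Comparison of the expectations of a bounded function under two laws. -/
lemma integral_withDensity_exp_le {Ω : Type*} [MeasurableSpace Ω] {P Q : Measure Ω}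
    [IsProbabilityMeasure P] [IsProbabilityMeasure Q] {Λ S : Ω → ℝ} (hΛ : Measurable Λ) {C T : ℝ}
    (hC : ∀ w, |Λ w| ≤ C) (hS : Measurable S) (h0 : ∀ w, 0 ≤ S w) (h1 : ∀ w, S w ≤ T)
    (hQ : Q = P.withDensity fun w => ENNReal.ofReal (Real.exp (Λ w))) :
    ∫ w, S w ∂Q ≤ ∫ w, S w ∂P + T * (8 * ∫ w, -Λ w ∂P + 1 / 8) := by
  have hpt : ∀ w, Real.exp (Λ w) * S w ≤
      S w + T * (8 * (Real.exp (Λ w) - 1 + -Λ w) + 1 / 16 * (Real.exp (Λ w) + 1)) := by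
    intro w
    set a := Real.exp (Λ w / 2) with ha
    have he : Real.exp (Λ w) = a ^ 2 := by rw [ha, ← Real.exp_nat_mul]; congr 1; push_cast; ring
    have hlog : Λ w / 2 + 1 ≤ a := Real.add_one_le_exp _
    -- From `hlog`, `a ^ 2 - 1 - Λ ≥ (a - 1) ^ 2`. Then AM-GM gives `(a - 1) * (a + 1) ≤ 8 * (a - 1)
    -- ^ 2 + (a + 1) ^ 2 / 32`, and `(a + 1) ^ 2 ≤ 2 * (a ^ 2 + 1)`.
    have hkey : a ^ 2 - 1 ≤ 8 * (a ^ 2 - 1 + -Λ w) + 1 / 16 * (a ^ 2 + 1) := by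
      nlinarith [sq_nonneg (16 * (a - 1) - (a + 1)), sq_nonneg (a - 1)]
    -- Nonnegativity of the right side allows the factor `S w` to be replaced by `T`.
    have hnn : 0 ≤ 8 * (a ^ 2 - 1 + -Λ w) + 1 / 16 * (a ^ 2 + 1) := by
      nlinarith [sq_nonneg (a - 1), sq_nonneg a]
    rw [he]
    nlinarith [mul_le_mul_of_nonneg_right hkey (h0 w), mul_le_mul_of_nonneg_right (h1 w) hnn]
  have hexp : Integrable (fun w => Real.exp (Λ w)) P :=
    FMDP.integrable_of_abs_le hΛ.exp (C := Real.exp C) fun w => by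
      rw [abs_of_pos (Real.exp_pos _)]; exact Real.exp_le_exp.2 ((le_abs_self _).trans (hC w))
  have hSi : Integrable S P := FMDP.integrable_of_abs_le hS (C := T) fun w => by
    rw [abs_of_nonneg (h0 w)]; exact h1 w
  have hΛi : Integrable (fun w => -Λ w) P := (FMDP.integrable_of_abs_le hΛ hC).neg
  have hmeas : Measurable fun w => ENNReal.ofReal (Real.exp (Λ w)) := hΛ.exp.ennreal_ofReal
  have hchange : ∀ f : Ω → ℝ, ∫ w, f w ∂Q = ∫ w, Real.exp (Λ w) * f w ∂P := fun f => by
    rw [hQ, integral_withDensity_eq_integral_toReal_smul hmeas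
      (Filter.Eventually.of_forall fun _ => ENNReal.ofReal_lt_top)]
    simp only [ENNReal.toReal_ofReal (Real.exp_pos _).le, smul_eq_mul]
  -- With total mass one, `exp Λ - 1` integrates to zero and `(exp Λ + 1) / 16` to `1/8`.
  have hone : ∫ w, Real.exp (Λ w) ∂P = 1 := by
    have := hchange fun _ => 1
    simpa using this.symm
  have hA : Integrable (fun w => 8 * (Real.exp (Λ w) - 1 + -Λ w)) P :=
    ((hexp.sub (integrable_const 1)).add hΛi).const_mul 8
  have hB : Integrable (fun w => 1 / 16 * (Real.exp (Λ w) + 1)) P :=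
    (hexp.add (integrable_const 1)).const_mul _
  have hAB : Integrable (fun w => 8 * (Real.exp (Λ w) - 1 + -Λ w) +
      1 / 16 * (Real.exp (Λ w) + 1)) P := hA.add hB
  have hexpS : Integrable (fun w => Real.exp (Λ w) * S w) P := by
    refine FMDP.integrable_of_abs_le (hΛ.exp.mul hS) (C := Real.exp C * T) fun w => ?_
    rw [abs_mul, abs_of_pos (Real.exp_pos _), abs_of_nonneg (h0 w)]
    exact mul_le_mul (Real.exp_le_exp.2 ((le_abs_self _).trans (hC w))) (h1 w) (h0 w)
      (Real.exp_pos _).le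
  rw [hchange]
  refine (integral_mono hexpS (hSi.add (hAB.const_mul T)) hpt).trans (le_of_eq ?_)
  rw [integral_add' hSi (hAB.const_mul T), integral_const_mul, integral_add hA hB,
    integral_const_mul, integral_const_mul, integral_add (f := fun w => Real.exp (Λ w) - 1) (hexp.sub (integrable_const 1)) hΛi,
    integral_sub hexp (integrable_const 1), integral_add hexp (integrable_const 1), hone]
  simp only [integral_const, probReal_univ, smul_eq_mul]
  ring

end FactoredMDP

/-! ### Bernoulli laws and their divergence. -/

namespace FactoredMDP

/-- The Bernoulli distribution on `{0, 1} ⊆ ℝ`. -/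
noncomputable def bernoulliMeasure (p : ℝ) : Measure ℝ :=
  ENNReal.ofReal (1 - p) • Measure.dirac 0 + ENNReal.ofReal p • Measure.dirac 1

lemma isProbabilityMeasure_bernoulliMeasure {p : ℝ} (hp : p ∈ Set.Icc (0 : ℝ) 1) :
    IsProbabilityMeasure (bernoulliMeasure p) := by
  constructor
  simp only [bernoulliMeasure, Measure.coe_add, Pi.add_apply, Measure.smul_apply, measure_univ,
    smul_eq_mul, mul_one]
  rw [← ENNReal.ofReal_add (by linarith [hp.2]) hp.1]
  simp

lemma ae_bernoulliMeasure (p : ℝ) {P : ℝ → Prop} (h0 : P 0) (h1 : P 1) :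
    ∀ᵐ y ∂bernoulliMeasure p, P y := by
  refine ae_add_measure_iff.2 ⟨Measure.ae_smul_measure ?_ _, Measure.ae_smul_measure ?_ _⟩
  · rw [ae_dirac_eq]; exact h0
  · rw [ae_dirac_eq]; exact h1

lemma bernoulliMeasure_zero : bernoulliMeasure 0 = Measure.dirac 0 := by
  simp [bernoulliMeasure]

lemma integrable_bernoulliMeasure (p : ℝ) (f : ℝ → ℝ) : Integrable f (bernoulliMeasure p) :=
  ((integrable_dirac enorm_lt_top).smul_measure ENNReal.ofReal_ne_top).add_measure
    ((integrable_dirac enorm_lt_top).smul_measure ENNReal.ofReal_ne_top)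

lemma integral_bernoulliMeasure {p : ℝ} (hp : p ∈ Set.Icc (0 : ℝ) 1) (f : ℝ → ℝ) :
    ∫ y, f y ∂bernoulliMeasure p = (1 - p) * f 0 + p * f 1 := by
  rw [bernoulliMeasure, integral_add_measure
    ((integrable_dirac enorm_lt_top).smul_measure ENNReal.ofReal_ne_top)
    ((integrable_dirac enorm_lt_top).smul_measure ENNReal.ofReal_ne_top)]
  simp [integral_smul_measure, ENNReal.toReal_ofReal hp.1,
    ENNReal.toReal_ofReal (show (0 : ℝ) ≤ 1 - p by linarith [hp.2])]

/-- The log-likelihood ratio of the Bernoulli distributions with means `1 / 2 + ε` and `1 / 2`. -/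
noncomputable def bernoulliLogRatio (ε y : ℝ) : ℝ :=
  if y < 1 / 2 then Real.log (1 - 2 * ε) else Real.log (1 + 2 * ε)

lemma measurable_bernoulliLogRatio (ε : ℝ) : Measurable (bernoulliLogRatio ε) :=
  Measurable.ite measurableSet_Iio measurable_const measurable_const

lemma bernoulliMeasure_withDensity {ε : ℝ} (h0 : 0 ≤ ε) (h1 : ε < 1 / 2) :
    bernoulliMeasure (1 / 2 + ε) = (bernoulliMeasure (1 / 2)).withDensity fun y =>
      ENNReal.ofReal (Real.exp (bernoulliLogRatio ε y)) := by
  have hm : Measurable fun y => ENNReal.ofReal (Real.exp (bernoulliLogRatio ε y)) :=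
    (measurable_bernoulliLogRatio ε).exp.ennreal_ofReal
  refine Measure.ext_of_lintegral _ fun f hf => ?_
  rw [lintegral_withDensity_eq_lintegral_mul _ hm hf]
  simp only [bernoulliMeasure, lintegral_add_measure, lintegral_smul_measure, lintegral_dirac,
    Pi.mul_apply, smul_eq_mul, ← mul_assoc]
  congr 2
  · rw [bernoulliLogRatio, if_pos (by norm_num), Real.exp_log (by linarith),
      ← ENNReal.ofReal_mul (by norm_num)]
    congr 1; ring
  · rw [bernoulliLogRatio, if_neg (by norm_num), Real.exp_log (by linarith),
      ← ENNReal.ofReal_mul (by norm_num)]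
    congr 1; ring

/-- The Kullback–Leibler divergence of the Bernoulli distributions with means `1 / 2` and
`1 / 2 + ε`. -/
noncomputable def bernoulliDiv (ε : ℝ) : ℝ :=
  -(1 / 2 * Real.log (1 - 2 * ε) + 1 / 2 * Real.log (1 + 2 * ε))

/-- The two logarithms combine to `log (1 - 4 * ε ^ 2)`, which is bounded below by `log x ≥ 1 - 1 /
x`. -/
lemma bernoulliDiv_le {ε : ℝ} (h0 : 0 ≤ ε) (h1 : ε ≤ 1 / 4) : bernoulliDiv ε ≤ 4 * ε ^ 2 := by
  have hpos : 0 < 1 - 4 * ε ^ 2 := by nlinarith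
  have h : bernoulliDiv ε = -(1 / 2 * Real.log (1 - 4 * ε ^ 2)) := by
    rw [bernoulliDiv, ← mul_add, ← Real.log_mul (by linarith) (by linarith)]
    ring_nf
  have hinv : (1 - 4 * ε ^ 2)⁻¹ ≤ 1 + 8 * ε ^ 2 := by
    rw [inv_le_iff_one_le_mul₀ hpos]
    nlinarith [mul_nonneg (sq_nonneg ε) (show (0 : ℝ) ≤ 1 - 8 * ε ^ 2 by nlinarith)]
  have := Real.one_sub_inv_le_log_of_pos hpos
  rw [h]; linarith

lemma integral_bernoulliLogRatio (ε : ℝ) :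
    ∫ y, bernoulliLogRatio ε y ∂bernoulliMeasure (1 / 2) = -bernoulliDiv ε := by
  rw [integral_bernoulliMeasure ⟨by norm_num, by norm_num⟩]
  norm_num [bernoulliLogRatio, bernoulliDiv]

/-! ### Bandit problems embedded in the factored structure. -/

variable {m q l H : ℕ} {X : Fin (m + q) → Type u}
  {ZP : Fin m → Finset (Fin (m + q))} {ZR : Fin l → Finset (Fin (m + q))}

open Classical in
/-- The number of steps of an episode at which the scope variable of component `i₀` is that
of `x`. -/
noncomputable def armCount (ZR : Fin l → Finset (Fin (m + q))) (i₀ : Fin l)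
    (x : (i : Fin (m + q)) → X i) (σ : Fin (H + 1) → State X) (α : Fin H → Action X) : ℝ :=
  ∑ h : Fin H, if scopeVar (ZR i₀) (pair (σ h.castSucc) (α h)) = scopeVar (ZR i₀) x then 1 else 0

lemma armCount_nonneg (i₀ : Fin l) (x : (i : Fin (m + q)) → X i) (σ : Fin (H + 1) → State X)
    (α : Fin H → Action X) : 0 ≤ armCount ZR i₀ x σ α :=
  Finset.sum_nonneg fun _ _ => by split_ifs <;> norm_num

lemma armCount_le (i₀ : Fin l) (x : (i : Fin (m + q)) → X i) (σ : Fin (H + 1) → State X)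
    (α : Fin H → Action X) : armCount ZR i₀ x σ α ≤ H :=
  (Finset.sum_le_card_nsmul _ _ 1 fun _ _ => by split_ifs <;> norm_num).trans (by simp)

/-- The reward means of the bandit problem in which the arm of `x` is better by `ε`. -/
noncomputable def banditMean (ZR : Fin l → Finset (Fin (m + q))) (i₀ : Fin l)
    (x : (i : Fin (m + q)) → X i) (ε : ℝ) (i : Fin l) (z : Scope X (ZR i)) : ℝ :=
  open Classical in
  if i = i₀ then 1 / 2 + (if z = scopeVar (ZR i) x then ε else 0) else 0

open Classical in
/-- The log-likelihood ratios of the rewards of the bandit problems with means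
`banditMean ZR i₀ x ε` and with means `1 / 2`. -/
noncomputable def banditLogRatio (ZR : Fin l → Finset (Fin (m + q))) (i₀ : Fin l)
    (x : (i : Fin (m + q)) → X i) (ε : ℝ) (i : Fin l) (z : Scope X (ZR i)) (y : ℝ) : ℝ :=
  if i = i₀ ∧ z = scopeVar (ZR i) x then bernoulliLogRatio ε y else 0

lemma measurable_banditLogRatio (i₀ : Fin l) (x : (i : Fin (m + q)) → X i) (ε : ℝ)
    (i : Fin l) (z : Scope X (ZR i)) :
    Measurable (banditLogRatio ZR i₀ x ε i z) := by
  unfold banditLogRatio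
  split_ifs
  · exact measurable_bernoulliLogRatio ε
  · exact measurable_const

lemma abs_banditLogRatio_le (i₀ : Fin l) (x : (i : Fin (m + q)) → X i) (ε : ℝ)
    (i : Fin l) (z : Scope X (ZR i)) (y : ℝ) :
    |banditLogRatio ZR i₀ x ε i z y| ≤ |Real.log (1 - 2 * ε)| + |Real.log (1 + 2 * ε)| := by
  have := abs_nonneg (Real.log (1 - 2 * ε))
  have := abs_nonneg (Real.log (1 + 2 * ε))
  unfold banditLogRatio bernoulliLogRatio
  split_ifs
  · linarith
  · linarith
  · rw [abs_zero]; positivity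

variable [∀ i, Fintype (X i)]

/-- An FMDP with Bernoulli rewards all components of which but one vanish. -/
noncomputable def bernoulliFMDP
    (tr : (i : Fin m) → Scope X (ZP i) → stdSimplex ℝ (X (Fin.castAdd q i))) (i₀ : Fin l)
    (p : (i : Fin l) → Scope X (ZR i) → ℝ) (hp : ∀ i z, p i z ∈ Set.Icc (0 : ℝ) 1)
    (h0 : ∀ i, i ≠ i₀ → ∀ z, p i z = 0) : FMDP X ZP ZR where
  trans := tr
  reward i z := ⟨bernoulliMeasure (p i z), isProbabilityMeasure_bernoulliMeasure (hp i z)⟩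
  reward_mem i z := ae_bernoulliMeasure _ (by simp) (by simp)
  total_mem x := by
    have hprob : ∀ i, IsProbabilityMeasure (bernoulliMeasure (p i (scopeVar (ZR i) x))) :=
      fun i => isProbabilityMeasure_bernoulliMeasure (hp _ _)
    -- Almost surely every component except `i₀` vanishes, so the total reward is one Bernoulli
    -- variable and stays in `[0, 1]`.
    have h : ∀ i, ∀ᵐ y ∂Measure.pi fun i => bernoulliMeasure (p i (scopeVar (ZR i) x)),
        y i ∈ Set.Icc (0 : ℝ) 1 ∧ (i ≠ i₀ → y i = 0) := fun i => by
      refine (measurePreserving_eval (fun i => bernoulliMeasure (p i (scopeVar (ZR i) x)))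
        i).quasiMeasurePreserving.ae (p := fun y => y ∈ Set.Icc (0 : ℝ) 1 ∧ (i ≠ i₀ → y = 0)) ?_
      by_cases hi : i = i₀
      · exact ae_bernoulliMeasure _ (by simp) (by simp [hi])
      · rw [h0 i hi, bernoulliMeasure_zero, ae_dirac_eq]
        simp
    filter_upwards [ae_all_iff.2 h] with y hy
    rw [Finset.sum_eq_single i₀ (fun i _ hi => (hy i).2 hi) (by simp)]
    exact (hy i₀).1

/-- The FMDP whose rewards form a bandit problem in which the arm of `x` is better by `ε`. -/
noncomputable def banditFMDP
    (tr : (i : Fin m) → Scope X (ZP i) → stdSimplex ℝ (X (Fin.castAdd q i)))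
    (ZR : Fin l → Finset (Fin (m + q))) (i₀ : Fin l)
    (x : (i : Fin (m + q)) → X i) {ε : ℝ} (h0 : 0 ≤ ε) (h1 : ε < 1 / 2) : FMDP X ZP ZR :=
  bernoulliFMDP tr i₀ (banditMean ZR i₀ x ε)
    (fun i z => by unfold banditMean; constructor <;> split_ifs <;> linarith)
    fun i hi z => by simp [banditMean, hi]

/-- The FMDP whose rewards form a bandit problem with all means equal to `1 / 2`. -/
noncomputable def fairFMDP
    (tr : (i : Fin m) → Scope X (ZP i) → stdSimplex ℝ (X (Fin.castAdd q i)))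
    (ZR : Fin l → Finset (Fin (m + q))) (i₀ : Fin l) : FMDP X ZP ZR :=
  bernoulliFMDP tr i₀ (fun i _ => if i = i₀ then 1 / 2 else 0)
    (fun i z => by constructor <;> split_ifs <;> norm_num)
    fun i hi z => by simp [hi]

variable (tr : (i : Fin m) → Scope X (ZP i) → stdSimplex ℝ (X (Fin.castAdd q i)))
  (i₀ : Fin l) (x : (i : Fin (m + q)) → X i) {ε : ℝ} (h0 : 0 ≤ ε) (h1 : ε < 1 / 2)

lemma banditFMDP_reward (i : Fin l) (z : Scope X (ZR i)) :
    ((banditFMDP tr ZR i₀ x h0 h1).reward i z : Measure ℝ) =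
      ((fairFMDP tr ZR i₀).reward i z : Measure ℝ).withDensity fun y =>
        ENNReal.ofReal (Real.exp (banditLogRatio ZR i₀ x ε i z y)) := by
  change bernoulliMeasure _ = (bernoulliMeasure _).withDensity _
  by_cases hi : i = i₀
  · by_cases hz : z = scopeVar (ZR i) x
    · simp only [banditMean, banditLogRatio, if_pos hi, if_pos hz, if_pos (And.intro hi hz)]
      exact bernoulliMeasure_withDensity h0 h1
    · simp [banditMean, banditLogRatio, hi, hz]
  · simp [banditMean, banditLogRatio, hi]

/-- Only the steps that play the arm of `x` distinguish the two problems, each contributing minus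
the divergence. The expectation is under the fair law, where the pulls of all arms can be summed. -/
lemma integral_rewardSum_banditLogRatio (s : State X) (π : Policy X H) :
    ∫ e, rewardSum ZR (banditLogRatio ZR i₀ x ε) e ∂(fairFMDP tr ZR i₀).episodeLaw s π =
      -bernoulliDiv ε * (fairFMDP tr ZR i₀).pathExp s π (armCount ZR i₀ x) := by
  rw [FMDP.integral_rewardSum _ _ _ fun i z => integrable_bernoulliMeasure _ _,
    ← FMDP.pathExp_mul]
  congr 1
  ext σ α
  rw [armCount, Finset.mul_sum]
  refine Finset.sum_congr rfl fun h _ => ?_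
  rw [Finset.sum_eq_single i₀ (fun i _ hi => by simp [banditLogRatio, hi]) (by simp)]
  change ∫ y, _ ∂bernoulliMeasure _ = _
  split_ifs with hz
  · simp only [banditLogRatio, hz, and_self, if_true, integral_bernoulliLogRatio, mul_one]
  · simp [banditLogRatio, hz]

/-- A step earns `1/2`, and `ε` more on the better arm. The path expectation can be taken in
`fairFMDP` because the transitions coincide. -/
lemma value_banditFMDP (s : State X) (π : Policy X H) :
    (banditFMDP tr ZR i₀ x h0 h1).value π s =
      H / 2 + ε * (fairFMDP tr ZR i₀).pathExp s π (armCount ZR i₀ x) := by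
  have h := FMDP.integral_rewardSum (banditFMDP tr ZR i₀ x h0 h1) s π (g := fun _ _ y => y)
    fun i z => integrable_bernoulliMeasure _ _
  refine h.trans ?_
  rw [FMDP.pathExp_congr (M₀ := fairFMDP tr ZR i₀) (M := banditFMDP tr ZR i₀ x h0 h1) rfl, ← FMDP.pathExp_mul,
    ← FMDP.pathExp_const (fairFMDP tr ZR i₀) s π ((H : ℝ) / 2), ← FMDP.pathExp_add]
  congr 1
  ext σ α
  have hH : (H : ℝ) / 2 = ∑ _h : Fin H, (1 / 2 : ℝ) := by simp; ring
  rw [armCount, Finset.mul_sum, hH, ← Finset.sum_add_distrib]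
  refine Finset.sum_congr rfl fun h _ => ?_
  have hmean : ∀ (i : Fin l) (z : Scope X (ZR i)),
      ∫ y, y ∂((banditFMDP tr ZR i₀ x h0 h1).reward i z : Measure ℝ) =
        banditMean ZR i₀ x ε i z := fun i z => by
    refine (integral_bernoulliMeasure (p := banditMean ZR i₀ x ε i z) ?_ fun y => y).trans (by ring)
    unfold banditMean; constructor <;> split_ifs <;> linarith
  simp_rw [hmean]
  rw [Finset.sum_eq_single i₀ (fun i _ hi => by simp [banditMean, hi]) (by simp)]
  simp [banditMean]

lemma pathExp_armCount_nonneg (s : State X) (π : Policy X H) :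
    0 ≤ (fairFMDP tr ZR i₀).pathExp s π (armCount ZR i₀ x) := by
  rw [← FMDP.pathExp_const (fairFMDP tr ZR i₀) s π 0]
  exact FMDP.pathExp_mono _ _ _ (armCount_nonneg _ _)

lemma pathExp_armCount_le (s : State X) (π : Policy X H) :
    (fairFMDP tr ZR i₀).pathExp s π (armCount ZR i₀ x) ≤ H := by
  rw [← FMDP.pathExp_const (fairFMDP tr ZR i₀) s π H]
  exact FMDP.pathExp_mono _ _ _ (armCount_le _ _)

/-- If some action always selects the arm of `x`, the optimal value is that of playing it. -/
lemma le_optValue_banditFMDP (s : State X) (a : Action X)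
    (ha : ∀ s, scopeVar (ZR i₀) (pair s a) = scopeVar (ZR i₀) x) :
    H / 2 + ε * H ≤ (banditFMDP tr ZR i₀ x h0 h1).optValue H s := by
  classical
  let π : Policy X H := fun _ _ => ⟨_, ite_eq_mem_stdSimplex ℝ a⟩
  -- The bound is needed because `optValue` is a real supremum, which would default to `0` on an
  -- unbounded set.
  have hbdd : BddAbove (Set.range fun π : Policy X H =>
      (banditFMDP tr ZR i₀ x h0 h1).value π s) := by
    refine ⟨H / 2 + ε * H, ?_⟩
    rintro _ ⟨π, rfl⟩
    simp only [value_banditFMDP]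
    gcongr
    exact pathExp_armCount_le tr i₀ x s π
  refine le_trans ?_ (le_ciSup hbdd π)
  rw [value_banditFMDP]
  gcongr
  rw [← FMDP.pathExp_const (fairFMDP tr ZR i₀) s π H]
  refine Finset.sum_le_sum fun τ _ => ?_
  by_cases hτ : ∀ h, τ.2 h = a
  · simp [armCount, hτ, ha]
  · obtain ⟨h, hh⟩ := not_forall.1 hτ
    -- A path that deviates from `a` has probability zero under the policy that always plays `a`.
    have hz : (fairFMDP tr ZR i₀).pathProb π (Fin.cons s τ.1) τ.2 = 0 :=
      Finset.prod_eq_zero (Finset.mem_univ h) (by simp [π, Ne.symm hh])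
    simp [hz]

end FactoredMDP

/-! ### Pull counts, the averaging argument and the regret bound. -/

namespace FactoredMDP

variable {m q l H : ℕ} {X : Fin (m + q) → Type u} [∀ i, Fintype (X i)]
  {ZP : Fin m → Finset (Fin (m + q))} {ZR : Fin l → Finset (Fin (m + q))}
  (tr : (i : Fin m) → Scope X (ZP i) → stdSimplex ℝ (X (Fin.castAdd q i)))

/-- The expected number of steps, under the policies of a history, at which the arm of `x` is
played. -/
noncomputable def pulls (ZR : Fin l → Finset (Fin (m + q))) (i₀ : Fin l) (s : State X)
    (x : (i : Fin (m + q)) → X i) {k : ℕ} (w : History X l H k) : ℝ :=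
  ∑ j, (fairFMDP tr ZR i₀).pathExp s (w j).1 (armCount ZR i₀ x)

variable (i₀ : Fin l) (s : State X) (x : (i : Fin (m + q)) → X i)

lemma measurable_pulls (k : ℕ) :
    Measurable (pulls (H := H) tr ZR i₀ s x : History X l H k → ℝ) :=
  Finset.measurable_sum _ fun j _ => (FMDP.measurable_pathExp _ _ _).comp
    (measurable_fst.comp (measurable_pi_apply j))

lemma pulls_nonneg {k : ℕ} (w : History X l H k) : 0 ≤ pulls tr ZR i₀ s x w :=
  Finset.sum_nonneg fun _ _ => pathExp_armCount_nonneg tr i₀ x s _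

lemma pulls_le {k : ℕ} (w : History X l H k) : pulls tr ZR i₀ s x w ≤ k * H :=
  (Finset.sum_le_card_nsmul _ _ (H : ℝ) fun _ _ => pathExp_armCount_le tr i₀ x s _).trans
    (by simp)

lemma integrable_pulls {k : ℕ} (μ : Measure (History X l H k)) [IsFiniteMeasure μ] :
    Integrable (pulls tr ZR i₀ s x) μ :=
  FMDP.integrable_of_abs_le (measurable_pulls tr i₀ s x k) fun w => by
    rw [abs_of_nonneg (pulls_nonneg tr i₀ s x w)]; exact pulls_le tr i₀ s x w

/-- Every step plays exactly one arm. -/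
lemma sum_pulls (x : Scope X (ZR i₀) → (i : Fin (m + q)) → X i)
    (hx : ∀ z, scopeVar (ZR i₀) (x z) = z) {k : ℕ} (w : History X l H k) :
    ∑ z, pulls tr ZR i₀ s (x z) w = k * H := by
  classical
  have hcount : ∀ (σ : Fin (H + 1) → State X) (α : Fin H → Action X),
      ∑ z, armCount ZR i₀ (x z) σ α = H := fun σ α => by
    simp only [armCount, hx]
    rw [Finset.sum_comm]
    simp
  simp only [pulls]
  rw [Finset.sum_comm]
  simp_rw [← FMDP.pathExp_sum, hcount, FMDP.pathExp_const]
  simp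

variable {ε : ℝ} (h0 : 0 ≤ ε) (h1 : ε < 1 / 2)

/-- An arm that is better by `ε` is played only a little more often than in the fair problem. -/
lemma integral_pulls_banditFMDP_le (alg : Algorithm X l H) (K : ℕ) :
    ∫ w, pulls tr ZR i₀ s x w ∂(banditFMDP tr ZR i₀ x h0 h1).historyLaw alg (fun _ => s) K ≤
      ∫ w, pulls tr ZR i₀ s x w ∂(fairFMDP tr ZR i₀).historyLaw alg (fun _ => s) K +
      K * H * (8 * (bernoulliDiv ε *
        ∫ w, pulls tr ZR i₀ s x w ∂(fairFMDP tr ZR i₀).historyLaw alg (fun _ => s) K) +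
          1 / 8) := by
  have hg := measurable_banditLogRatio (ZR := ZR) i₀ x ε
  -- The log-ratio is bounded at every real reward, not only at `0` and `1`, so the bound is uniform
  -- over all histories.
  have hC := abs_rewardSum_le (H := H) (abs_banditLogRatio_le (ZR := ZR) i₀ x ε)
  set C := (H : ℝ) * (l * (|Real.log (1 - 2 * ε)| + |Real.log (1 + 2 * ε)|))
  have hΛ : ∀ w : History X l H K,
      |∑ j, rewardSum ZR (banditLogRatio ZR i₀ x ε) (w j).2| ≤ K * C := fun w =>
    (Finset.abs_sum_le_sum_abs _ _).trans
      ((Finset.sum_le_card_nsmul _ _ C fun j _ => hC _).trans (by simp))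
  have hΛm : Measurable fun w : History X l H K =>
      ∑ j, rewardSum ZR (banditLogRatio ZR i₀ x ε) (w j).2 :=
    Finset.measurable_sum _ fun j _ => (measurable_rewardSum hg).comp
      (measurable_snd.comp (measurable_pi_apply j))
  refine (integral_withDensity_exp_le hΛm hΛ (measurable_pulls tr i₀ s x K)
    (pulls_nonneg tr i₀ s x) (pulls_le tr i₀ s x)
    (FMDP.historyLaw_withDensity (M₀ := fairFMDP tr ZR i₀) (M := banditFMDP tr ZR i₀ x h0 h1) hg rfl (banditFMDP_reward tr i₀ x h0 h1) alg _ K)).trans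
    (le_of_eq ?_)
  -- The mean of `-Λ` under the fair history law is `bernoulliDiv ε` times the expected number of
  -- pulls.
  have hdiv := FMDP.integral_historyLaw_sum (fairFMDP tr ZR i₀) alg s
    (F := fun p => rewardSum ZR (banditLogRatio ZR i₀ x ε) p.2)
    ((measurable_rewardSum hg).comp measurable_snd) (fun p => hC p.2)
    ((FMDP.measurable_pathExp _ s (armCount ZR i₀ x)).const_mul (-bernoulliDiv ε))
    (integral_rewardSum_banditLogRatio tr i₀ x s) K
  simp_rw [← Finset.mul_sum] at hdiv
  rw [integral_const_mul] at hdiv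
  rw [integral_neg, hdiv]
  simp only [pulls]
  ring

/-- The regret in terms of the number of steps at which the best arm is not played. -/
lemma le_expectedRegret_banditFMDP (a : Action X)
    (ha : ∀ s, scopeVar (ZR i₀) (pair s a) = scopeVar (ZR i₀) x) (alg : Algorithm X l H) (K : ℕ) :
    ε * (K * H - ∫ w, pulls tr ZR i₀ s x w
      ∂(banditFMDP tr ZR i₀ x h0 h1).historyLaw alg (fun _ => s) K) ≤
      (banditFMDP tr ZR i₀ x h0 h1).expectedRegret alg (fun _ => s) K := by
  set M := banditFMDP (ZP := ZP) tr ZR i₀ x h0 h1 with hM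
  have hint := integrable_pulls (ZR := ZR) tr i₀ s x (M.historyLaw alg (fun _ => s) K)
  have hsum : ∀ w : History X l H K,
      ∑ k : Fin K, (M.optValue H s - M.value (w k).1 s) =
        K * (M.optValue H s - H / 2) - ε * pulls tr ZR i₀ s x w := fun w => by
    simp only [hM, value_banditFMDP, pulls, Finset.mul_sum, Finset.sum_sub_distrib,
      Finset.sum_add_distrib]
    simp
    ring
  have hreg : M.expectedRegret alg (fun _ => s) K = K * (M.optValue H s - H / 2) -
      ε * ∫ w, pulls tr ZR i₀ s x w ∂M.historyLaw alg (fun _ => s) K := by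
    unfold FMDP.expectedRegret
    simp_rw [hsum]
    rw [integral_sub (integrable_const _) (hint.const_mul ε), integral_const_mul ε]
    simp
  have hopt : H / 2 + ε * H ≤ M.optValue H s := le_optValue_banditFMDP tr i₀ x h0 h1 s a ha
  rw [hreg]
  nlinarith [mul_le_mul_of_nonneg_left hopt (Nat.cast_nonneg (α := ℝ) K)]

/-- Every algorithm has large regret on one of the bandit problems with a fixed reward scope. -/
lemma exists_le_expectedRegret [∀ i, Nonempty (X i)] (hZ : ∀ j ∈ ZR i₀, m ≤ (j : ℕ))
    (h2 : 2 ≤ scopeCard X (ZR i₀)) (K : ℕ) (hK : scopeCard X (ZR i₀) ≤ K * H)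
    (alg : Algorithm X l H) :
    ∃ (M : FMDP X ZP ZR) (s₁ : ℕ → State X),
      1 / 128 * √((scopeCard X (ZR i₀) : ℝ) * ((K : ℝ) * (H : ℝ))) ≤
        M.expectedRegret alg s₁ K := by
  classical
  let tr : (i : Fin m) → Scope X (ZP i) → stdSimplex ℝ (X (Fin.castAdd q i)) :=
    fun i _ => ⟨_, ite_eq_mem_stdSimplex ℝ (Classical.arbitrary _)⟩
  let s : State X := Classical.arbitrary _
  let x : Scope X (ZR i₀) → (i : Fin (m + q)) → X i := fun z i =>
    if h : i ∈ ZR i₀ then z ⟨i, h⟩ else Classical.arbitrary _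
  let a : Scope X (ZR i₀) → Action X := fun z j => x z (Fin.natAdd m j)
  have hx : ∀ z, scopeVar (ZR i₀) (x z) = z := fun z => by
    ext i; simp [scopeVar, x]
  -- Every index of the scope is an action component, so `a z` selects arm `z` whatever the state.
  have ha : ∀ z s, scopeVar (ZR i₀) (pair s (a z)) = scopeVar (ZR i₀) (x z) := fun z s => by
    ext ⟨i, hi⟩
    obtain ⟨j, rfl⟩ : ∃ j, i = Fin.natAdd m j :=
      ⟨Fin.subNat m (Fin.cast (Nat.add_comm _ _) i) (hZ i hi), by ext; simp⟩
    exact Fin.addCases_right _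
  set N := scopeCard X (ZR i₀) with hN
  set T : ℝ := (K : ℝ) * H with hT
  have hN2 : (2 : ℝ) ≤ N := by exact_mod_cast h2
  have hNT : (N : ℝ) ≤ T := by rw [hT]; exact_mod_cast hK
  have hTpos : 0 < T := by linarith
  -- This scale makes `ε ^ 2 * T` proportional to `N`: an arm pulled `T / N` times has divergence of
  -- order one. The condition `N ≤ T` keeps `ε ≤ 1/16`.
  set ε : ℝ := 1 / 16 * √(N / T) with hε
  have hsqrt : √((N : ℝ) / T) ≤ 1 := Real.sqrt_le_one.2 ((div_le_one hTpos).2 hNT)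
  have h0 : 0 ≤ ε := by positivity
  have h1 : ε < 1 / 2 := by linarith
  have hsq : ε ^ 2 * T = N / 256 := by
    rw [hε, mul_pow, Real.sq_sqrt (by positivity)]
    field_simp
    norm_num
  have hεT : ε * T = 1 / 16 * √(N * T) := by
    rw [hε, mul_assoc, show √((N : ℝ) / T) * T = √(N / T) * √(T ^ 2) by rw [Real.sqrt_sq hTpos.le],
      ← Real.sqrt_mul (by positivity)]
    congr 2
    field_simp
  have hdiv := bernoulliDiv_le h0 (by linarith)
  obtain ⟨z, hz⟩ : ∃ z, ∫ w, pulls tr ZR i₀ s (x z) w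
      ∂(banditFMDP tr ZR i₀ (x z) h0 h1).historyLaw alg (fun _ => s) K ≤ 7 / 8 * T := by
    -- If every arm failed, summing over the `N` arms would give `7/8 * N * T < T + 8 * T * N / 64 +
    -- N * T / 8 = T + N * T / 4`, at least in the weak form. This is false since `T ≤ N * T / 2`
    -- for `N ≥ 2`.
    by_contra! hcon
    have hE : ∑ z, ∫ w, pulls tr ZR i₀ s (x z) w
        ∂(fairFMDP tr ZR i₀).historyLaw alg (fun _ => s) K = T := by
      rw [← integral_finsetSum _ fun z _ => integrable_pulls tr i₀ s (x z) _]
      simp [sum_pulls tr i₀ s x hx, hT]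
    have hle := Finset.sum_le_sum fun z (_ : z ∈ Finset.univ) =>
      (hcon z).le.trans (integral_pulls_banditFMDP_le tr i₀ s (x z) h0 h1 alg K)
    have hcard : (Fintype.card (Scope X (ZR i₀)) : ℝ) = N := rfl
    simp only [Finset.sum_add_distrib, ← Finset.mul_sum, hE, Finset.sum_const, Finset.card_univ,
      nsmul_eq_mul, hcard] at hle
    rw [← hT] at hle
    have hNdiv : T * (bernoulliDiv ε * T) ≤ T * (N / 64) := by gcongr; nlinarith
    nlinarith
  refine ⟨banditFMDP tr ZR i₀ (x z) h0 h1, fun _ => s, le_trans ?_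
    (le_expectedRegret_banditFMDP tr i₀ s (x z) h0 h1 (a z) (ha z) alg K)⟩
  -- At least `T / 8` expected pulls miss the best arm, and `ε * T / 8 = √(N * T) / 128` by `hεT`.
  nlinarith [mul_le_mul_of_nonneg_left hz h0]

end FactoredMDP

open FactoredMDP
theorem mainTheorem7 :
    ∃ c : ℝ, 0 < c ∧
      ∀ (m q l H K : ℕ) (X : Fin (m + q) → Type u) [∀ i, Fintype (X i)] [∀ i, Nonempty (X i)]
        (ZP : Fin m → Finset (Fin (m + q))) (ZR : Fin l → Finset (Fin (m + q))),
        (∀ i, ∀ j ∈ ZR i, m ≤ (j : ℕ)) →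
        (∃ i, 2 ≤ scopeCard X (ZR i)) →
        (∀ i, scopeCard X (ZR i) ≤ K * H) →
        ∀ alg : Algorithm X l H,
          ∃ (M : FMDP X ZP ZR) (s₁ : ℕ → State X),
            c * (⨆ i, √((scopeCard X (ZR i) : ℝ) * ((K : ℝ) * (H : ℝ)))) ≤
              M.expectedRegret alg s₁ K := by
  refine ⟨1 / 128, by norm_num, ?_⟩
  intro m q l H K X _ _ ZP ZR hZ h2 hK alg
  obtain ⟨i, hi⟩ := h2
  have : Nonempty (Fin l) := ⟨i⟩
  -- The largest scope attains the supremum and inherits cardinality at least `2` from scope `i`.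
  obtain ⟨i₀, hmax⟩ := Finite.exists_max fun i => scopeCard X (ZR i)
  obtain ⟨M, s₁, hM⟩ :=
    exists_le_expectedRegret (ZP := ZP) i₀ (hZ i₀) (hi.trans (hmax i)) K (hK i₀) alg
  refine ⟨M, s₁, le_trans ?_ hM⟩
  gcongr
  refine ciSup_le fun j => Real.sqrt_le_sqrt ?_
  gcongr
  exact hmax j
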